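/- **Setting.** Let $S\subseteq\mathbb R^n$ be nonempty, closed and convex, let $m\ge 1$ and $\ell>0$. For $i=1,\dots,m$ let $f_i$ be a real function that is $C^1$ on a neighbourhood of $S$, let $g_i\colon S\to\mathbb R$ be convex and continuous, and put $F_i=f_i+g_i$. Define on $S$ $$w_\ell(x)=\max_{y\in S}\min_{1\le i\le m}\Big\{\nabla f_i(x)^\top(x-y)+g_i(x)-g_i(y)-\tfrac{\ell}{2}\|x-y\|^2\Big\}.$$ For a closed proper convex $h\colon\mathbb R^n\to\mathbb R\cup\{\infty\}$ let $\mathrm{env}_h(u)=\min_y\{h(y)+\frac12\|u-y\|^2\}$ and let $\mathrm{prox}_h(u)$ be the unique minimizer. Let $\iota_S$ be the indicator function of $S$ ($0$ on $S$, $\infty$ elsewhere) and $\Delta^m$ the standard simplex. For $\gamma\in\Delta^m$ write $v_\gamma(x)=\sum_i\gamma_i\nabla f_i(x)$, $H_\gamma(x)=\sum_i\gamma_i\nabla^2f_i(x)$, $p_\gamma(x)=\mathrm{prox}_{\frac1\ell\sum_i\gamma_ig_i+\iota_S}\big(x-\frac1\ell v_\gamma(x)\big)$, and let $$\Gamma(x)=\operatorname*{argmin}_{\gamma\in\Delta^m}\Big\{\sum_i\gamma_ig_i(x)+\tfrac1{2\ell}\|v_\gamma(x)\|^2-\ell\,\mathrm{env}_{\frac1\ell\sum_i\gamma_ig_i+\iota_S}\big(x-\tfrac1\ell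 v_\gamma(x)\big)\Big\}.$$ Write $h'(x;d)=\lim_{t\searrow0}(h(x+td)-h(x))/t$ when this limit exists in $\mathbb R$. A function $h\colon S\to\mathbb R$ is called *continuously differentiable at the point $x\in S$ with gradient $a$* if $a$ is a gradient of $h$ at $x$ relative to $S$, the differentiability is strict, that is $h(y)-h(z)=a^\top(y-z)+o(\|y-z\|)$ as $y,z\to x$ in $S$, and, when $S$ has nonempty interior, the gradient map $\nabla h$, defined at the points of $S$ where $h$ is differentiable relative to $S$, is continuous at $x$. **Theorem.** Let $x\in S$ and let every $f_i$ be $C^2$ in a neighbourhood of $x$. 1. For every $z\in S$ for which the derivatives $g_i'(x;z-x)$, $i=1,\dots,m$, are finite, $w_\ell$ has a (finite) directional derivative at $x$ in the direction $z-x$, and $$w_\ell'(x;z-x)=\inf_{\gamma\in\Gamma(x)}\Big\{\sum_i\gamma_ig_i'(x;z-x)-\ell\Big(\big[I-\tfrac1\ell H_\gamma(x)\big]\big[x-p_\gamma(x)\big]-\tfrac1\ell v_\gamma(x)\Big)^{\top}(z-x)\Big\}.$$ 2. If $\Gamma(x)=\{\gamma\}$ and each $g_i$ is continuously differentiable at $x$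 with gradient $\nabla g_i(x)$, then $w_\ell$ is continuously differentiable at $x$ with gradient $$\nabla w_\ell(x)=\sum_i\gamma_i\nabla F_i(x)-\ell\big[I-\tfrac1\ell H_\gamma(x)\big]\big[x-p_\gamma(x)\big].$$ If moreover $\Gamma(y)$ is a singleton for all $y\in S$ near $x$ and the $g_i$ are $C^1$ on a neighbourhood of $x$ in $S$, then $w_\ell$ is $C^1$ on a neighbourhood of $x$ in $S$. 3. Suppose $g_i=g_1$ for all $i$ (no differentiability of $g_1$ is assumed). If $\Gamma(x)=\{\gamma\}$, then $w_\ell-g_1$ is continuously differentiable at $x$ with gradient $$\nabla(w_\ell-g_1)(x)=-\ell\big[I-\tfrac1\ell H_\gamma(x)\big]\Big[x-\mathrm{prox}_{\frac1\ell g_1+\iota_S}\big(x-\tfrac1\ell v_\gamma(x)\big)\Big]+v_\gamma(x).$$ If moreover $\Gamma(y)$ is a singleton for all $y\in S$ near $x$, then $w_\ell-g_1$ is $C^1$ on a neighbourhood of $x$ in $S$. -/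

import Mathlib

open Filter Topology Set

noncomputable section

namespace CompositeMerit

/-- Euclidean space `ℝⁿ`. -/
abbrev E (n : ℕ) : Type := EuclideanSpace ℝ (Fin n)

variable {n m : ℕ}

/-! ### Directional derivatives and continuous differentiability at a point -/

/-- `L` is the (finite) one-sided directional derivative of `h` at `x` in the direction `d`:
`L = lim_{t ↘ 0} (h (x + t d) - h x) / t`. -/
def HasDirDeriv (h : E n → ℝ) (x d : E n) (L : ℝ) : Prop :=
  Tendsto (fun t : ℝ => (h (x + t • d) - h x) / t) (𝓝[>] 0) (𝓝 L)

/-- The function `h`, regarded as a function on `S`, is continuously differentiable at the point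
`x`, with gradient `a`:
* `a` is a gradient of `h : S → ℝ` at `x`;
* the differentiability is strict, that is
  `h y - h z = ⟪a, y - z⟫ + o(‖y - z‖)` as `y, z → x` in `S`;
* if `S` has interior points (so that gradients on the convex set `S` are unique), then
  the gradient map `∇h`, defined at the points of `S` where `h` is differentiable,
  is continuous at `x`. -/
structure HasContinuousGradientAt (S : Set (E n)) (h : E n → ℝ) (a x : E n) : Prop where
  hasGradient : HasGradientWithinAt h a S x
  strict : HasFDerivAtFilter h (InnerProductSpace.toDual ℝ (E n) a) (𝓝[S] x ×ˢ 𝓝[S] x)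
  continuous : (interior S).Nonempty →
    ContinuousWithinAt (gradientWithin h S) {y ∈ S | DifferentiableWithinAt ℝ h S y} x

/-- The Hessian `∇²f(x)`, as a linear operator on `ℝⁿ`. -/
def hessian (f : E n → ℝ) (x : E n) : E n →L[ℝ] E n :=
  fderiv ℝ (gradient f) x

/-! ### Moreau envelope and proximal operator of extended-real-valued functions -/

/-- The indicator function of `C` : `0` on `C` and `+∞` outside `C`. -/
def indicatorFn (C : Set (E n)) (y : E n) : EReal :=
  open Classical in if y ∈ C then 0 else ⊤

/-- The objective `y ↦ h y + ½ ‖x - y‖²`. -/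
def proxObjective (h : E n → EReal) (x y : E n) : EReal :=
  h y + ((1 / 2 * ‖x - y‖ ^ 2 : ℝ) : EReal)

/-- The Moreau envelope `env_h (x) = inf_y { h y + ½ ‖x - y‖² }`. -/
def moreauEnv (h : E n → EReal) (x : E n) : EReal :=
  ⨅ y, proxObjective h x y

/-- The proximal operator `prox_h (x) = argmin_y { h y + ½ ‖x - y‖² }`
(the minimizer exists and is unique when `h` is closed, proper and convex). -/
def prox (h : E n → EReal) (x : E n) : E n :=
  Classical.epsilon fun p => IsMinOn (proxObjective h x) univ p

/-- The function `(1/ℓ) g + ι_S`. -/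
def scaledAddIndicator (S : Set (E n)) (ℓ : ℝ) (g : E n → ℝ) (y : E n) : EReal :=
  ((1 / ℓ * g y : ℝ) : EReal) + indicatorFn S y

/-! ### The merit function and its dual problem -/

/-- `w_ℓ(x) = max_{y ∈ S} min_i { ∇f_i(x)ᵀ(x - y) + g_i(x) - g_i(y) - (ℓ/2) ‖x - y‖² }`. -/
def merit (S : Set (E n)) (f g : Fin m → E n → ℝ) (ℓ : ℝ) (x : E n) : ℝ :=
  ⨆ y : S, ⨅ i : Fin m,
    (inner ℝ (gradient (f i) x) (x - (y : E n)) + g i x - g i y - ℓ / 2 * ‖x - (y : E n)‖ ^ 2)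

/-- `∑ γ_i ∇f_i(x)`. -/
def wGrad (f : Fin m → E n → ℝ) (γ : Fin m → ℝ) (x : E n) : E n :=
  ∑ i, γ i • gradient (f i) x

/-- `∑ γ_i ∇²f_i(x)`. -/
def wHess (f : Fin m → E n → ℝ) (γ : Fin m → ℝ) (x : E n) : E n →L[ℝ] E n :=
  ∑ i, γ i • hessian (f i) x

/-- `(1/ℓ) ∑ γ_i g_i + ι_S`. -/
def wReg (S : Set (E n)) (g : Fin m → E n → ℝ) (ℓ : ℝ) (γ : Fin m → ℝ) : E n → EReal :=
  scaledAddIndicator S ℓ fun y => ∑ i, γ i * g i y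

/-- The objective of the dual problem:
`∑ γ_i g_i(x) + (1/2ℓ) ‖∑ γ_i ∇f_i(x)‖²
  - ℓ env_{(1/ℓ) ∑ γ_i g_i + ι_S} (x - (1/ℓ) ∑ γ_i ∇f_i(x))`. -/
def dualObjective (S : Set (E n)) (f g : Fin m → E n → ℝ) (ℓ : ℝ) (x : E n)
    (γ : Fin m → ℝ) : ℝ :=
  ∑ i, γ i * g i x + 1 / (2 * ℓ) * ‖wGrad f γ x‖ ^ 2
    - ℓ * (moreauEnv (wReg S g ℓ γ) (x - (1 / ℓ) • wGrad f γ x)).toReal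

/-- `Γ(x)`, the set of minimizers of the dual objective over the standard simplex. -/
def dualSolutions (S : Set (E n)) (f g : Fin m → E n → ℝ) (ℓ : ℝ) (x : E n) :
    Set (Fin m → ℝ) :=
  {γ ∈ stdSimplex ℝ (Fin m) | IsMinOn (dualObjective S f g ℓ x) (stdSimplex ℝ (Fin m)) γ}

end CompositeMerit

end

open CompositeMerit

namespace CompositeMerit

/-! ### Maximization of concave functions -/

/-! Averaging the functions inside the minimum with weights γ gives a Lagrangian that is affine in γ
and strongly concave in y. Completing the square in y shows that its partial maximum over S is the
dual objective, attained at p_γ(x). Strict concavity makes p_γ(x) jointly continuous in (x, γ), so Γ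
has nonempty compact values and closed graph. Moving γ slightly towards another weight shows that
(γ, p_γ(x)) is a saddle point for γ ∈ Γ(x), hence w_ℓ(x) is the dual minimum (`merit_eq`).

All differentiability then comes from one inequality (`merit_sub_merit_le`): for γ ∈ Γ(z), the
increment w_ℓ(y) - w_ℓ(z) is at most ∑ γ_i (g_i(y) - g_i(z)) plus the increment of the smooth
coupling with its last argument frozen at p_γ(y). Exchanging y and z gives the lower bound. The
coupling is jointly C¹, so its increments linearize uniformly in γ and in the proximal point
(`isLittleO_coupling`). Along a ray, limits of dual solutions lie in Γ(x), and the two bounds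
squeeze the quotient to a minimum over Γ(x), as in Danskin's theorem. When Γ(x) is a singleton, dual
solutions converge to it along every approach to x, and the bounds give strict differentiability; on
a convex set with interior points this forces continuity of the gradient map. If the g_i coincide,
subtracting g₁ cancels the nonsmooth terms. -/

/-- A continuous strongly concave function attains its maximum on a closed set. -/
theorem exists_isMaxOn_of_strongConcaveOn {V : Type*} [NormedAddCommGroup V] [NormedSpace ℝ V]
    [ProperSpace V] {S : Set V} {φ : V → ℝ} {ℓ : ℝ} (hℓ : 0 < ℓ) (hne : S.Nonempty)
    (hcl : IsClosed S) (hcont : ContinuousOn φ S) (hφ : StrongConcaveOn S ℓ φ) :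
    ∃ p ∈ S, IsMaxOn φ S p := by
  obtain ⟨y₀, hy₀⟩ := hne
  obtain ⟨q₀, ⟨hq₀S, hq₀b⟩, hq₀⟩ : ∃ q ∈ S ∩ Metric.closedBall y₀ 1,
      IsMaxOn φ (S ∩ Metric.closedBall y₀ 1) q :=
    ((isCompact_closedBall y₀ 1).inter_left hcl).exists_isMaxOn
      ⟨y₀, hy₀, by simp⟩ (hcont.mono inter_subset_left)
  have hM : φ y₀ ≤ φ q₀ := hq₀ ⟨hy₀, by simp⟩
  -- Beyond this radius the quadratic loss `(r - 1) * (ℓ / 2)` exceeds the gain `φ q₀ - φ y₀`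
  -- possible in the unit ball, so φ falls to at most `φ y₀`.
  set R : ℝ := 1 + 2 * (φ q₀ - φ y₀) / ℓ with hR
  have hR1 : 1 ≤ R := by
    have : 0 ≤ 2 * (φ q₀ - φ y₀) / ℓ := div_nonneg (by linarith) hℓ.le
    linarith
  refine hcont.exists_isMaxOn' hcl hy₀ ?_
  rw [eventually_inf_principal]
  filter_upwards [(isCompact_closedBall y₀ R).compl_mem_cocompact] with y hy hyS
  simp only [mem_compl_iff, Metric.mem_closedBall, not_le, dist_eq_norm] at hy
  set r := ‖y - y₀‖ with hr
  have hr1 : 1 < r := lt_of_le_of_lt hR1 hy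
  have hr0 : 0 < r := by linarith
  obtain ⟨hconv, hφ'⟩ := hφ
  -- The weight `1 / r` places the convex combination at distance one from `y₀`, where `φ q₀` is an
  -- upper bound.
  have key := hφ' hyS hy₀ (a := 1 / r) (b := 1 - 1 / r) (by positivity)
    (by rw [sub_nonneg, div_le_one hr0]; exact hr1.le) (by ring)
  have hmem : (1 / r) • y + (1 - 1 / r) • y₀ ∈ S :=
    hconv hyS hy₀ (by positivity) (by rw [sub_nonneg, div_le_one hr0]; exact hr1.le) (by ring)
  have hball : (1 / r) • y + (1 - 1 / r) • y₀ ∈ Metric.closedBall y₀ 1 := by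
    have : (1 / r) • y + (1 - 1 / r) • y₀ - y₀ = (1 / r) • (y - y₀) := by module
    rw [Metric.mem_closedBall, dist_eq_norm, this, norm_smul, ← hr, Real.norm_of_nonneg
      (by positivity), one_div_mul_cancel hr0.ne']
  have hle : φ ((1 / r) • y + (1 - 1 / r) • y₀) ≤ φ q₀ := hq₀ ⟨hmem, hball⟩
  simp only [smul_eq_mul, ← hr] at key
  have h2 : 1 / r * φ y + (1 - 1 / r) * φ y₀ + 1 / r * (1 - 1 / r) * (ℓ / 2 * r ^ 2) ≤ φ q₀ :=
    key.trans hle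
  have h3 : φ y + (r - 1) * φ y₀ + (r - 1) * r * (ℓ / 2) ≤ r * φ q₀ := by
    have := mul_le_mul_of_nonneg_left h2 hr0.le
    have e : r * (1 / r * φ y + (1 - 1 / r) * φ y₀ + 1 / r * (1 - 1 / r) * (ℓ / 2 * r ^ 2)) =
        φ y + (r - 1) * φ y₀ + (r - 1) * r * (ℓ / 2) := by
      field_simp
    linarith
  have h4 : φ q₀ - φ y₀ ≤ (r - 1) * (ℓ / 2) := by
    have : 2 * (φ q₀ - φ y₀) / ℓ ≤ r - 1 := by linarith
    rw [div_le_iff₀ hℓ] at this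
    linarith
  have h5 := mul_le_mul_of_nonneg_left h4 hr0.le
  linarith

/-- The unique maximizer over a closed convex set of a family of concave functions depends
continuously on the parameter. -/
theorem continuous_of_isMaxOn_concaveOn {P V : Type*} [TopologicalSpace P]
    [NormedAddCommGroup V] [NormedSpace ℝ V] [ProperSpace V] {S : Set V} (hcl : IsClosed S)
    {Φ : P → V → ℝ} (hcont : Continuous fun z : P × S => Φ z.1 z.2)
    (hconc : ∀ q, StrictConcaveOn ℝ S (Φ q)) {p : P → V} (hpS : ∀ q, p q ∈ S)
    (hp : ∀ q, IsMaxOn (Φ q) S (p q)) : Continuous p := by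
  rw [continuous_iff_continuousAt]
  intro q₀
  rw [ContinuousAt, Metric.tendsto_nhds]
  intro ε hε
  set K : Set S := {y | dist (y : V) (p q₀) = ε}
  have hK : IsCompact K :=
    hcl.isClosedEmbedding_subtypeVal.isCompact_preimage (isCompact_sphere (p q₀) ε)
  have hlt : ∀ y ∈ K, Φ q₀ y < Φ q₀ (p q₀) := by
    intro y hy
    refine lt_of_le_of_ne (hp q₀ y.2) fun h => ?_
    have : (y : V) = p q₀ := (hconc q₀).eq_of_isMaxOn
      (fun z hz => (hp q₀ hz).trans h.ge) (hp q₀) y.2 (hpS q₀)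
    have hy' : dist (y : V) (p q₀) = ε := hy
    rw [this, dist_self] at hy'
    exact hε.ne hy'
  -- By compactness of the sphere, the strict inequality persists for nearby parameters. A maximizer
  -- outside the sphere would then contradict concavity on the segment to `p q₀`, which crosses the
  -- sphere.
  have hev : ∀ᶠ q in 𝓝 q₀, ∀ y ∈ K, Φ q y < Φ q (p q₀) := by
    refine hK.eventually_forall_of_forall_eventually fun y hy => ?_
    have hc : Continuous fun z : P × S => Φ z.1 (p q₀) :=
      hcont.comp (continuous_fst.prodMk (continuous_const (y := (⟨p q₀, hpS q₀⟩ : S))))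
    exact (hcont.tendsto (q₀, y)).eventually_lt (hc.tendsto (q₀, y)) (hlt y hy)
  filter_upwards [hev] with q hq
  by_contra! hd
  set d := dist (p q) (p q₀) with hdd
  have hd0 : 0 < d := hε.trans_le hd
  have ha : 0 ≤ ε / d := by positivity
  have hb : 0 ≤ 1 - ε / d := by rw [sub_nonneg, div_le_one hd0]; exact hd
  have hmem := (hconc q).1 (hpS q) (hpS q₀) ha hb (by ring)
  have hdist : dist ((ε / d) • p q + (1 - ε / d) • p q₀) (p q₀) = ε := by
    have : (ε / d) • p q + (1 - ε / d) • p q₀ - p q₀ = (ε / d) • (p q - p q₀) := by module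
    rw [dist_eq_norm, this, norm_smul, ← dist_eq_norm, ← hdd, Real.norm_of_nonneg ha,
      div_mul_cancel₀ _ hd0.ne']
  have h1 := hq ⟨_, hmem⟩ hdist
  have h2 := (hconc q).concaveOn.2 (hpS q) (hpS q₀) ha hb (by ring)
  have h3 : Φ q (p q₀) ≤ Φ q (p q) := hp q (hpS q₀)
  simp only [smul_eq_mul] at h2
  nlinarith [mul_le_mul_of_nonneg_left h3 ha]

/-! ### Strict differentiability on convex sets with interior points -/

/-- If `h` is strictly differentiable at `x` relative to a convex set `S`, then it is continuously
differentiable at `x` relative to `S`. -/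
theorem HasContinuousGradientAt.of_strict {n : ℕ} {S : Set (E n)} (hS : Convex ℝ S)
    {h : E n → ℝ} {a x : E n} (hx : x ∈ S)
    (hstrict : HasFDerivAtFilter h (InnerProductSpace.toDual ℝ (E n) a) (𝓝[S] x ×ˢ 𝓝[S] x)) :
    HasContinuousGradientAt S h a x := by
  refine ⟨hstrict.mono (prod_mono le_rfl (pure_le_nhdsWithin hx)), hstrict, ?_⟩
  have hgx : HasGradientWithinAt h a S x :=
    hstrict.mono (prod_mono le_rfl (pure_le_nhdsWithin hx))
  rintro ⟨c, hc⟩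
  obtain ⟨r, hr, hcr⟩ := Metric.mem_nhds_iff.1 (mem_interior_iff_mem_nhds.1 hc)
  -- a uniform bound on gradients at differentiability points near `x`
  have main : ∀ ε > 0, ∀ᶠ y in 𝓝[S] x, ∀ b, HasGradientWithinAt h b S y →
      ‖b - a‖ * (r / 2) ≤ 4 * ε * (‖c - x‖ + 1 + r) := by
    intro ε hε
    have h1 : ∀ᶠ p : E n × E n in 𝓝[S] x ×ˢ 𝓝[S] x,
        ‖h p.1 - h p.2 - inner ℝ a (p.1 - p.2)‖ ≤ ε * ‖p.1 - p.2‖ := by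
      simpa using hstrict.isLittleO.def hε
    obtain ⟨U, hU, hUb⟩ := mem_prod_self_iff.1 h1
    have hU' := eventually_eventually_nhdsWithin.2 hU
    filter_upwards [hU', hU, self_mem_nhdsWithin,
      mem_nhdsWithin_of_mem_nhds (Metric.ball_mem_nhds x one_pos)] with y hyU' hyU hyS hy1 b hb
    have h2 : ∀ᶠ z in 𝓝[S] y, ‖h z - h y - inner ℝ b (z - y)‖ ≤ ε * ‖z - y‖ := by
      have := HasFDerivAtFilter.isLittleO hb
      rw [prod_pure] at this
      simpa using this.def hε
    have h3 : ∀ᶠ z in 𝓝[S] y, |inner ℝ (b - a) (z - y)| ≤ 2 * ε * ‖z - y‖ := by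
      filter_upwards [h2, hyU'] with z hz2 hzU
      have h4 : ‖h z - h y - inner ℝ a (z - y)‖ ≤ ε * ‖z - y‖ := @hUb (z, y) ⟨hzU, hyU⟩
      rw [inner_sub_left]
      rw [Real.norm_eq_abs, abs_le] at hz2 h4
      rw [abs_le]
      constructor <;> linarith [hz2.1, hz2.2, h4.1, h4.2]
    -- Both sides of `h3` are positively homogeneous in `z - y`, so the local bound extends along
    -- segments to all of S.
    have hdir : ∀ u ∈ S, |inner ℝ (b - a) (u - y)| ≤ 2 * ε * ‖u - y‖ := by
      intro u hu
      have ht : Tendsto (fun t : ℝ => y + t • (u - y)) (𝓝[>] 0) (𝓝[S] y) := by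
        refine tendsto_nhdsWithin_iff.2 ⟨?_, ?_⟩
        · have : Continuous fun t : ℝ => y + t • (u - y) := by fun_prop
          simpa using (this.tendsto 0).mono_left nhdsWithin_le_nhds
        · filter_upwards [Ioc_mem_nhdsGT (zero_lt_one' ℝ)] with t ht
          exact hS.add_smul_sub_mem hyS hu ⟨ht.1.le, ht.2⟩
      obtain ⟨t, ht1, ht2⟩ := ((ht.eventually h3).and self_mem_nhdsWithin).exists
      have ht0 : (0 : ℝ) < t := ht2
      rw [add_sub_cancel_left, inner_smul_right, norm_smul, abs_mul, Real.norm_eq_abs,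
        abs_of_pos ht0] at ht1
      refine le_of_mul_le_mul_left ?_ ht0
      linarith
    by_cases hba : b - a = 0
    · rw [hba]; simp; positivity
    have hn : 0 < ‖b - a‖ := norm_pos_iff.2 hba
    -- Both `c` and `c + e` lie in the interior ball; subtracting the bounds at these two points
    -- isolates `‖b - a‖`.
    set e : E n := (r / 2 / ‖b - a‖) • (b - a) with he
    have hen : ‖e‖ = r / 2 := by
      rw [he, norm_smul, Real.norm_of_nonneg (by positivity), div_mul_cancel₀ _ hn.ne']
    have heS : c + e ∈ S := hcr (by
      rw [Metric.mem_ball, dist_eq_norm, add_sub_cancel_left, hen]; linarith)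
    have h5 := hdir _ heS
    have h6 := hdir _ (hcr (Metric.mem_ball_self hr))
    have hin : inner ℝ (b - a) e = ‖b - a‖ * (r / 2) := by
      rw [he, inner_smul_right, real_inner_self_eq_norm_sq]; field_simp
    have hsplit : inner ℝ (b - a) (c + e - y) =
        inner ℝ (b - a) (c - y) + ‖b - a‖ * (r / 2) := by
      rw [← hin, ← inner_add_right]; congr 1; abel
    have hcy : ‖c - y‖ ≤ ‖c - x‖ + 1 := by
      have h7 : ‖x - y‖ ≤ 1 := by
        rw [← dist_eq_norm, dist_comm]; exact (Metric.mem_ball.1 hy1).le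
      have := norm_sub_le_norm_sub_add_norm_sub c x y
      linarith
    have hcey : ‖c + e - y‖ ≤ ‖c - x‖ + 1 + r := by
      have : c + e - y = (c - y) + e := by abel
      rw [this]
      linarith [norm_add_le (c - y) e]
    rw [hsplit, abs_le] at h5
    rw [abs_le] at h6
    nlinarith [h5.2, h6.1, mul_le_mul_of_nonneg_left hcy hε.le,
      mul_le_mul_of_nonneg_left hcey hε.le, mul_pos hε hr]
  rw [ContinuousWithinAt, Metric.tendsto_nhds]
  have hM : 0 < ‖c - x‖ + 1 + r := by positivity
  have hsmall : ∀ δ > 0, ∀ᶠ y in 𝓝[S] x, ∀ b, HasGradientWithinAt h b S y → ‖b - a‖ < δ := by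
    intro δ hδ
    filter_upwards [main (δ * r / (16 * (‖c - x‖ + 1 + r))) (by positivity)] with y hy b hb
    have h1 := hy b hb
    have e : 4 * (δ * r / (16 * (‖c - x‖ + 1 + r))) * (‖c - x‖ + 1 + r) = δ * r / 4 := by
      field_simp; norm_num
    rw [e] at h1
    by_contra! hcon
    nlinarith [mul_le_mul_of_nonneg_right hcon hr.le, mul_pos hδ hr]
  intro δ hδ
  have hx' := (hsmall (δ / 2) (by positivity)).self_of_nhdsWithin hx _
    hgx.hasFDerivWithinAt.differentiableWithinAt.hasGradientWithinAt
  filter_upwards [nhdsWithin_mono x (sep_subset S _) (hsmall (δ / 2) (by positivity)),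
    self_mem_nhdsWithin] with y hy hyS
  have := hy _ hyS.2.hasGradientWithinAt
  have h8 := dist_triangle_right (gradientWithin h S y) (gradientWithin h S x) a
  rw [dist_eq_norm (gradientWithin h S y) a, dist_eq_norm (gradientWithin h S x) a] at h8
  linarith

/-! ### The Lagrangian of the max-min problem -/

/-- The smooth part `⟪v_γ(x), x - y⟫ - (ℓ/2) ‖x - y‖²` of the Lagrangian. -/
noncomputable def coupling {n m : ℕ} (f : Fin m → E n → ℝ) (ℓ : ℝ) (γ : Fin m → ℝ) (x y : E n) :
    ℝ :=
  inner ℝ (wGrad f γ x) (x - y) - ℓ / 2 * ‖x - y‖ ^ 2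

/-- The Lagrangian: the `γ`-average of the functions whose minimum defines the merit function. -/
noncomputable def lagrangian {n m : ℕ} (f g : Fin m → E n → ℝ) (ℓ : ℝ) (γ : Fin m → ℝ)
    (x y : E n) : ℝ :=
  ∑ i, γ i * g i x + coupling f ℓ γ x y - ∑ i, γ i * g i y

/-- The proximal point `p_γ(x)`. -/
noncomputable def proxPoint {n m : ℕ} (S : Set (E n)) (f g : Fin m → E n → ℝ) (ℓ : ℝ)
    (γ : Fin m → ℝ) (x : E n) : E n :=
  prox (wReg S g ℓ γ) (x - (1 / ℓ) • wGrad f γ x)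

/-- The standing assumptions on the data of the merit function. -/
structure Admissible {n m : ℕ} (S : Set (E n)) (f g : Fin m → E n → ℝ) (ℓ : ℝ) : Prop where
  nonempty : S.Nonempty
  closed : IsClosed S
  convex : Convex ℝ S
  grad_cont : ∀ i, ContinuousOn (gradient (f i)) S
  g_conv : ∀ i, ConvexOn ℝ S (g i)
  g_cont : ∀ i, ContinuousOn (g i) S
  pos : 0 < ℓ
  m_pos : 0 < m

variable {n m : ℕ} {S : Set (E n)} {f g : Fin m → E n → ℝ} {ℓ : ℝ}

theorem tendsto_of_continuousOn_prod {α β δ ι : Type*} [TopologicalSpace α] [TopologicalSpace β]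
    [TopologicalSpace δ] {s : Set α} {t : Set β} (F : α → β → δ)
    (hF : ContinuousOn (fun q : α × β => F q.1 q.2) (s ×ˢ t)) {a : α} {b : β} (ha : a ∈ s)
    (hb : b ∈ t) {l : Filter ι} {X : ι → α} {Y : ι → β} (hX : Tendsto X l (𝓝[s] a))
    (hY : Tendsto Y l (𝓝[t] b)) : Tendsto (fun i => F (X i) (Y i)) l (𝓝 (F a b)) := by
  have h := hF (a, b) ⟨ha, hb⟩
  rw [ContinuousWithinAt, nhdsWithin_prod_eq] at h
  exact h.comp (hX.prodMk hY)

theorem continuousAt_gradient {f : E n → ℝ} {y : E n} (hf : ContDiffAt ℝ 1 f y) :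
    ContinuousAt (gradient f) y :=
  (InnerProductSpace.toDual ℝ (E n)).symm.continuous.continuousAt.comp
    (hf.continuousAt_fderiv one_ne_zero)

/-- The weights sum to one, so the quadratic term can be moved inside the average. This makes the
affine dependence on γ visible, which the saddle point argument needs. -/
theorem lagrangian_eq_sum {γ : Fin m → ℝ} (hγ : γ ∈ stdSimplex ℝ (Fin m)) (x y : E n) :
    lagrangian f g ℓ γ x y = ∑ i, γ i * (inner ℝ (gradient (f i) x) (x - y) + g i x - g i y
      - ℓ / 2 * ‖x - y‖ ^ 2) := by
  have h : ℓ / 2 * ‖x - y‖ ^ 2 = ∑ i, γ i * (ℓ / 2 * ‖x - y‖ ^ 2) := by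
    rw [← Finset.sum_mul, hγ.2, one_mul]
  simp only [lagrangian, coupling, wGrad, sum_inner, real_inner_smul_left]
  generalize ℓ / 2 * ‖x - y‖ ^ 2 = s at h ⊢
  conv_lhs => rw [h]
  simp only [← Finset.sum_add_distrib, ← Finset.sum_sub_distrib]
  exact Finset.sum_congr rfl fun i _ => by ring

/-- Completing the square turns maximization in y into the proximal problem. -/
theorem lagrangian_eq_sq (hℓ : 0 < ℓ) (γ : Fin m → ℝ) (x y : E n) :
    lagrangian f g ℓ γ x y = ∑ i, γ i * g i x + 1 / (2 * ℓ) * ‖wGrad f γ x‖ ^ 2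
      - ℓ * (1 / ℓ * ∑ i, γ i * g i y + 1 / 2 * ‖x - (1 / ℓ) • wGrad f γ x - y‖ ^ 2) := by
  have e : x - (1 / ℓ) • wGrad f γ x - y = (x - y) - (1 / ℓ) • wGrad f γ x := by abel
  rw [e, @norm_sub_sq_real, norm_smul, inner_smul_right, real_inner_comm, mul_pow,
    Real.norm_of_nonneg (by positivity : (0 : ℝ) ≤ 1 / ℓ)]
  simp only [lagrangian, coupling]
  field_simp
  ring

/-- Adding `ℓ / 2 * ‖y‖ ^ 2` cancels the quadratic part in y and leaves an affine function minus a
convex one. -/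
theorem Admissible.strongConcaveOn_lagrangian (A : Admissible S f g ℓ) {γ : Fin m → ℝ}
    (hγ : γ ∈ stdSimplex ℝ (Fin m)) (x : E n) :
    StrongConcaveOn S ℓ (lagrangian f g ℓ γ x) := by
  rw [strongConcaveOn_iff_convex]
  have h1 : ConvexOn ℝ S fun y => ∑ i, γ i * g i y := by
    refine ⟨A.convex, fun y hy z hz a b ha hb hab => ?_⟩
    simp only [smul_eq_mul, Finset.mul_sum, ← Finset.sum_add_distrib]
    refine Finset.sum_le_sum fun i _ => ?_
    have := mul_le_mul_of_nonneg_left ((A.g_conv i).2 hy hz ha hb hab) (hγ.1 i)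
    simp only [smul_eq_mul] at this
    linarith
  have h2 : ConcaveOn ℝ S fun y => ∑ i, γ i * g i x + inner ℝ (wGrad f γ x) x
      - ℓ / 2 * ‖x‖ ^ 2 + inner ℝ (ℓ • x - wGrad f γ x) y := by
    refine ⟨A.convex, fun y _ z _ a b _ _ hab => le_of_eq ?_⟩
    simp only [inner_add_right, inner_smul_right, smul_eq_mul]
    rw [← eq_sub_iff_add_eq'] at hab
    subst hab
    ring
  refine (h2.sub h1).congr fun y _ => ?_
  simp only [lagrangian, coupling, Pi.sub_apply, @norm_sub_sq_real, inner_sub_right,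
    inner_sub_left, inner_smul_left]
  simp
  ring

theorem Admissible.continuousOn_wGrad (A : Admissible S f g ℓ) :
    ContinuousOn (fun q : E n × (Fin m → ℝ) => wGrad f q.2 q.1)
      (S ×ˢ stdSimplex ℝ (Fin m)) := by
  unfold wGrad
  refine continuousOn_finsetSum _ fun i _ =>
    (by fun_prop : Continuous fun q : E n × (Fin m → ℝ) => q.2 i).continuousOn.smul ?_
  exact (A.grad_cont i).comp continuousOn_fst fun q hq => hq.1

theorem Admissible.continuousOn_lagrangian (A : Admissible S f g ℓ) :
    ContinuousOn (fun z : (E n × (Fin m → ℝ)) × E n => lagrangian f g ℓ z.1.2 z.1.1 z.2)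
      ((S ×ˢ stdSimplex ℝ (Fin m)) ×ˢ S) := by
  have hg : ∀ i, ContinuousOn (fun z : (E n × (Fin m → ℝ)) × E n => g i z.2)
      ((S ×ˢ stdSimplex ℝ (Fin m)) ×ˢ S) := fun i =>
    (A.g_cont i).comp continuousOn_snd fun q hq => hq.2
  have hg' : ∀ i, ContinuousOn (fun z : (E n × (Fin m → ℝ)) × E n => g i z.1.1)
      ((S ×ˢ stdSimplex ℝ (Fin m)) ×ˢ S) := fun i =>
    (A.g_cont i).comp (continuous_fst.comp continuous_fst).continuousOn fun q hq => hq.1.1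
  have hv : ContinuousOn (fun z : (E n × (Fin m → ℝ)) × E n => wGrad f z.1.2 z.1.1)
      ((S ×ˢ stdSimplex ℝ (Fin m)) ×ˢ S) :=
    A.continuousOn_wGrad.comp continuousOn_fst fun q hq => hq.1
  unfold lagrangian coupling
  refine ((continuousOn_finsetSum _ fun i _ => ContinuousOn.mul (by fun_prop) (hg' i)).add
    ((hv.inner (by fun_prop)).sub (by fun_prop))).sub
    (continuousOn_finsetSum _ fun i _ => ContinuousOn.mul (by fun_prop) (hg i))

/-! ### Proximal points as maximizers of the Lagrangian -/

theorem proxObjective_of_mem {h : E n → ℝ} {u y : E n} (hy : y ∈ S) :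
    proxObjective (scaledAddIndicator S ℓ h) u y
      = ((1 / ℓ * h y + 1 / 2 * ‖u - y‖ ^ 2 : ℝ) : EReal) := by
  simp [proxObjective, scaledAddIndicator, indicatorFn, hy]

theorem proxObjective_of_notMem {h : E n → ℝ} {u y : E n} (hy : y ∉ S) :
    proxObjective (scaledAddIndicator S ℓ h) u y = ⊤ := by
  rw [proxObjective, scaledAddIndicator, indicatorFn, if_neg hy, EReal.coe_add_top,
    EReal.top_add_coe]

theorem isMinOn_proxObjective_iff (hS : S.Nonempty) {h : E n → ℝ} {u p : E n} :
    IsMinOn (proxObjective (scaledAddIndicator S ℓ h) u) univ p ↔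
      p ∈ S ∧ IsMinOn (fun y => 1 / ℓ * h y + 1 / 2 * ‖u - y‖ ^ 2) S p := by
  constructor
  · intro hp
    obtain ⟨s, hs⟩ := hS
    have hpS : p ∈ S := by
      by_contra hpS
      have := hp (mem_univ s)
      rw [mem_ofPred_eq, proxObjective_of_mem hs, proxObjective_of_notMem hpS, top_le_iff] at this
      exact EReal.coe_ne_top _ this
    refine ⟨hpS, fun y hy => ?_⟩
    have := hp (mem_univ y)
    rw [mem_ofPred_eq, proxObjective_of_mem hy, proxObjective_of_mem hpS] at this
    exact EReal.coe_le_coe_iff.1 this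
  · rintro ⟨hpS, hp⟩ y -
    by_cases hy : y ∈ S
    · rw [mem_ofPred_eq, proxObjective_of_mem hy, proxObjective_of_mem hpS]
      exact EReal.coe_le_coe_iff.2 (hp hy)
    · rw [mem_ofPred_eq, proxObjective_of_notMem hy]
      exact le_top

theorem isMinOn_proxObjective_wReg_iff (hS : S.Nonempty) (hℓ : 0 < ℓ) {γ : Fin m → ℝ}
    {x p : E n} :
    IsMinOn (proxObjective (wReg S g ℓ γ) (x - (1 / ℓ) • wGrad f γ x)) univ p ↔
      p ∈ S ∧ IsMaxOn (lagrangian f g ℓ γ x) S p := by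
  rw [wReg, isMinOn_proxObjective_iff hS]
  refine and_congr_right fun _ => forall₂_congr fun y _ => ?_
  rw [mem_ofPred_eq, mem_ofPred_eq, lagrangian_eq_sq hℓ, lagrangian_eq_sq hℓ, sub_le_sub_iff_left,
    mul_le_mul_iff_right₀ hℓ]

theorem Admissible.proxPoint_spec (A : Admissible S f g ℓ) {γ : Fin m → ℝ}
    (hγ : γ ∈ stdSimplex ℝ (Fin m)) (x : E n) (hx : x ∈ S) :
    IsMinOn (proxObjective (wReg S g ℓ γ) (x - (1 / ℓ) • wGrad f γ x)) univ
      (proxPoint S f g ℓ γ x) := by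
  obtain ⟨p, hpS, hp⟩ := exists_isMaxOn_of_strongConcaveOn A.pos A.nonempty A.closed
    (φ := lagrangian f g ℓ γ x)
    (A.continuousOn_lagrangian.comp (f := fun y => ((x, γ), y)) (by fun_prop)
      fun y hy => ⟨⟨hx, hγ⟩, hy⟩) (A.strongConcaveOn_lagrangian hγ x)
  exact Classical.epsilon_spec (p := fun p => IsMinOn _ univ p)
    ⟨p, (isMinOn_proxObjective_wReg_iff A.nonempty A.pos).2 ⟨hpS, hp⟩⟩

theorem Admissible.proxPoint_mem (A : Admissible S f g ℓ) {γ : Fin m → ℝ}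
    (hγ : γ ∈ stdSimplex ℝ (Fin m)) {x : E n} (hx : x ∈ S) : proxPoint S f g ℓ γ x ∈ S :=
  ((isMinOn_proxObjective_wReg_iff A.nonempty A.pos).1 (A.proxPoint_spec hγ x hx)).1

theorem Admissible.isMaxOn_proxPoint (A : Admissible S f g ℓ) {γ : Fin m → ℝ}
    (hγ : γ ∈ stdSimplex ℝ (Fin m)) {x : E n} (hx : x ∈ S) :
    IsMaxOn (lagrangian f g ℓ γ x) S (proxPoint S f g ℓ γ x) :=
  ((isMinOn_proxObjective_wReg_iff A.nonempty A.pos).1 (A.proxPoint_spec hγ x hx)).2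

/-- The dual objective is the partial maximum of the Lagrangian. -/
theorem Admissible.dualObjective_eq (A : Admissible S f g ℓ) {γ : Fin m → ℝ}
    (hγ : γ ∈ stdSimplex ℝ (Fin m)) {x : E n} (hx : x ∈ S) :
    dualObjective S f g ℓ x γ = lagrangian f g ℓ γ x (proxPoint S f g ℓ γ x) := by
  have hp := A.proxPoint_spec hγ x hx
  have h1 : moreauEnv (wReg S g ℓ γ) (x - (1 / ℓ) • wGrad f γ x)
      = proxObjective (wReg S g ℓ γ) (x - (1 / ℓ) • wGrad f γ x) (proxPoint S f g ℓ γ x) :=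
    le_antisymm (iInf_le _ _) (le_iInf fun y => hp (mem_univ y))
  rw [dualObjective, h1, wReg, proxObjective_of_mem (A.proxPoint_mem hγ hx), EReal.toReal_coe,
    lagrangian_eq_sq A.pos]

theorem Admissible.continuousOn_proxPoint (A : Admissible S f g ℓ) :
    ContinuousOn (fun q : E n × (Fin m → ℝ) => proxPoint S f g ℓ q.2 q.1)
      (S ×ˢ stdSimplex ℝ (Fin m)) := by
  rw [continuousOn_iff_continuous_domRestrict]
  refine continuous_of_isMaxOn_concaveOn A.closed
    (Φ := fun q : ↥(S ×ˢ stdSimplex ℝ (Fin m)) => lagrangian f g ℓ q.1.2 q.1.1) ?_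
    (fun q => (A.strongConcaveOn_lagrangian q.2.2 _).strictConcaveOn A.pos)
    (fun q => A.proxPoint_mem q.2.2 q.2.1) (fun q => A.isMaxOn_proxPoint q.2.2 q.2.1)
  exact A.continuousOn_lagrangian.comp_continuous
    (f := fun z : ↥(S ×ˢ stdSimplex ℝ (Fin m)) × S => ((z.1 : E n × (Fin m → ℝ)), (z.2 : E n)))
    (by fun_prop) fun z => ⟨z.1.2, z.2.2⟩

theorem Admissible.continuousOn_dualObjective (A : Admissible S f g ℓ) :
    ContinuousOn (fun q : E n × (Fin m → ℝ) => dualObjective S f g ℓ q.1 q.2)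
      (S ×ˢ stdSimplex ℝ (Fin m)) :=
  (A.continuousOn_lagrangian.comp (continuousOn_id.prodMk A.continuousOn_proxPoint)
    fun _ hq => ⟨hq, A.proxPoint_mem hq.2 hq.1⟩).congr fun _ hq => A.dualObjective_eq hq.2 hq.1

/-! ### The dual solution map and strong duality -/

theorem Admissible.dualSolutions_nonempty (A : Admissible S f g ℓ) {x : E n} (hx : x ∈ S) :
    (dualSolutions S f g ℓ x).Nonempty := by
  have hc : ContinuousOn (dualObjective S f g ℓ x) (stdSimplex ℝ (Fin m)) :=
    A.continuousOn_dualObjective.comp (f := fun γ => (x, γ)) (by fun_prop) fun γ hγ => ⟨hx, hγ⟩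
  obtain ⟨γ, hγ, hmin⟩ := (isCompact_stdSimplex ℝ (Fin m)).exists_isMinOn
    ⟨_, single_mem_stdSimplex ℝ (⟨0, A.m_pos⟩ : Fin m)⟩ hc
  exact ⟨γ, hγ, hmin⟩

/-- The solution map of the dual problem has closed graph. -/
theorem Admissible.mem_dualSolutions_of_tendsto (A : Admissible S f g ℓ) {ι : Type*}
    {l : Filter ι} [l.NeBot] {X : ι → E n} {c : ι → Fin m → ℝ} {x : E n} {γ : Fin m → ℝ}
    (hx : x ∈ S) (hX : Tendsto X l (𝓝[S] x)) (hc : Tendsto c l (𝓝 γ))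
    (hmem : ∀ᶠ t in l, c t ∈ dualSolutions S f g ℓ (X t)) : γ ∈ dualSolutions S f g ℓ x := by
  have hcΔ : ∀ᶠ t in l, c t ∈ stdSimplex ℝ (Fin m) := hmem.mono fun t ht => ht.1
  have hγ : γ ∈ stdSimplex ℝ (Fin m) := (isClosed_stdSimplex ℝ (Fin m)).mem_of_tendsto hc hcΔ
  refine ⟨hγ, fun γ' hγ' => ?_⟩
  have h1 := tendsto_of_continuousOn_prod (dualObjective S f g ℓ) A.continuousOn_dualObjective hx
    hγ hX (tendsto_nhdsWithin_iff.2 ⟨hc, hcΔ⟩)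
  have h2 := tendsto_of_continuousOn_prod (dualObjective S f g ℓ) A.continuousOn_dualObjective hx
    hγ' hX (tendsto_const_nhdsWithin hγ')
  exact le_of_tendsto_of_tendsto h1 h2 (hmem.mono fun t ht => ht.2 hγ')

theorem Admissible.isCompact_dualSolutions (A : Admissible S f g ℓ) {x : E n} (hx : x ∈ S) :
    IsCompact (dualSolutions S f g ℓ x) := by
  refine (isCompact_stdSimplex ℝ (Fin m)).of_isClosed_subset ?_ fun γ hγ => hγ.1
  refine isClosed_of_closure_subset fun γ hγ => ?_
  rw [mem_closure_iff_nhdsWithin_neBot] at hγ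
  exact A.mem_dualSolutions_of_tendsto (l := 𝓝[dualSolutions S f g ℓ x] γ) (c := id) hx
    (X := fun _ => x) (tendsto_const_nhdsWithin hx) (tendsto_id.mono_left nhdsWithin_le_nhds) self_mem_nhdsWithin

/-- A selection of the solution map is continuous where the solution is unique. -/
theorem Admissible.tendsto_of_dualSolutions_eq_singleton (A : Admissible S f g ℓ) {ι : Type*}
    {l : Filter ι} {X : ι → E n} {c : ι → Fin m → ℝ} {x : E n} {γ : Fin m → ℝ}
    (hx : x ∈ S) (hX : Tendsto X l (𝓝[S] x)) (hΓ : dualSolutions S f g ℓ x = {γ})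
    (hmem : ∀ᶠ t in l, c t ∈ dualSolutions S f g ℓ (X t)) : Tendsto c l (𝓝 γ) := by
  rw [tendsto_iff_ultrafilter]
  intro U hU
  -- Compactness gives a limit along every ultrafilter, and the closed graph identifies it with γ.
  obtain ⟨γ₁, -, h₁⟩ := (isCompact_stdSimplex ℝ (Fin m)).ultrafilter_le_nhds (U.map c)
    (by
      rw [le_principal_iff]
      exact hU (hmem.mono fun t ht => ht.1))
  have hc : Tendsto c U (𝓝 γ₁) := h₁
  have := A.mem_dualSolutions_of_tendsto hx (hX.mono_left hU) hc (hU hmem)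
  rw [hΓ, mem_singleton_iff] at this
  rwa [← this]

/-- A dual solution and its proximal point form a saddle point of the Lagrangian. -/
theorem Admissible.dualObjective_le_lagrangian (A : Admissible S f g ℓ) {x : E n} (hx : x ∈ S)
    {γ γ' : Fin m → ℝ} (hγ : γ ∈ dualSolutions S f g ℓ x) (hγ' : γ' ∈ stdSimplex ℝ (Fin m)) :
    dualObjective S f g ℓ x γ ≤ lagrangian f g ℓ γ' x (proxPoint S f g ℓ γ x) := by
  -- At the proximal point p of `c s`, dual optimality of γ gives L(c s, p) ≥ D(γ) ≥ L(γ, p).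
  -- Affinity in the multiplier yields L(γ', p) ≥ D(γ), and then s tends to 0.
  set c : ℝ → Fin m → ℝ := fun s => (1 - s) • γ + s • γ' with hc
  have hcΔ : ∀ᶠ s in 𝓝[>] (0 : ℝ), c s ∈ stdSimplex ℝ (Fin m) := by
    filter_upwards [Ioc_mem_nhdsGT (zero_lt_one' ℝ)] with s hs
    exact convex_stdSimplex ℝ (Fin m) hγ.1 hγ' (by linarith [hs.2]) hs.1.le (by ring)
  have hc0 : Tendsto c (𝓝[>] 0) (𝓝 γ) := by
    have : Continuous c := by fun_prop
    simpa [hc] using (this.tendsto 0).mono_left nhdsWithin_le_nhds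
  have hp := tendsto_of_continuousOn_prod (fun x γ => proxPoint S f g ℓ γ x)
    A.continuousOn_proxPoint hx hγ.1 (tendsto_const_nhdsWithin hx)
    (tendsto_nhdsWithin_iff.2 ⟨hc0, hcΔ⟩)
  have hL := tendsto_of_continuousOn_prod
    (fun (q : E n × (Fin m → ℝ)) y => lagrangian f g ℓ q.2 q.1 y) A.continuousOn_lagrangian
    (mk_mem_prod hx hγ') (A.proxPoint_mem hγ.1 hx)
    (tendsto_const_nhdsWithin (mk_mem_prod hx hγ'))
    (tendsto_nhdsWithin_iff.2 ⟨hp, hcΔ.mono fun s hs => A.proxPoint_mem hs hx⟩)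
  refine ge_of_tendsto hL ?_
  filter_upwards [hcΔ, Ioc_mem_nhdsGT (zero_lt_one' ℝ)] with s hs hs1
  set p := proxPoint S f g ℓ (c s) x with hpdef
  have h1 : dualObjective S f g ℓ x γ ≤ lagrangian f g ℓ (c s) x p := by
    rw [hpdef, ← A.dualObjective_eq hs hx]; exact hγ.2 hs
  have h2 : lagrangian f g ℓ γ x p ≤ dualObjective S f g ℓ x γ := by
    rw [A.dualObjective_eq hγ.1 hx]; exact A.isMaxOn_proxPoint hγ.1 hx (A.proxPoint_mem hs hx)
  have h3 : lagrangian f g ℓ (c s) x p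
      = (1 - s) * lagrangian f g ℓ γ x p + s * lagrangian f g ℓ γ' x p := by
    rw [lagrangian_eq_sum hs, lagrangian_eq_sum hγ.1, lagrangian_eq_sum hγ', Finset.mul_sum,
      Finset.mul_sum, ← Finset.sum_add_distrib]
    refine Finset.sum_congr rfl fun i _ => ?_
    simp only [hc, Pi.add_apply, Pi.smul_apply, smul_eq_mul]
    ring
  refine le_of_mul_le_mul_left ?_ hs1.1
  nlinarith [mul_le_mul_of_nonneg_left h2 (by linarith [hs1.2] : 0 ≤ 1 - s)]

/-- Strong duality: the merit function is the optimal value of the dual problem. -/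
theorem Admissible.merit_eq (A : Admissible S f g ℓ) {x : E n} (hx : x ∈ S)
    {γ : Fin m → ℝ} (hγ : γ ∈ dualSolutions S f g ℓ x) :
    merit S f g ℓ x = dualObjective S f g ℓ x γ := by
  have : Nonempty (Fin m) := ⟨⟨0, A.m_pos⟩⟩
  have : Nonempty S := A.nonempty.to_subtype
  set φ : Fin m → E n → ℝ := fun i y =>
    inner ℝ (gradient (f i) x) (x - y) + g i x - g i y - ℓ / 2 * ‖x - y‖ ^ 2 with hφ
  have hub : ∀ y : S, ⨅ i, φ i y ≤ dualObjective S f g ℓ x γ := by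
    intro y
    have h1 : lagrangian f g ℓ γ x y ≤ dualObjective S f g ℓ x γ := by
      rw [A.dualObjective_eq hγ.1 hx]; exact A.isMaxOn_proxPoint hγ.1 hx y.2
    refine le_trans ?_ h1
    rw [lagrangian_eq_sum hγ.1, ← one_mul (⨅ i, φ i y), ← hγ.1.2, Finset.sum_mul]
    exact Finset.sum_le_sum fun i _ =>
      mul_le_mul_of_nonneg_left (ciInf_le (finite_range _).bddBelow i) (hγ.1.1 i)
  refine le_antisymm (ciSup_le hub) ?_
  refine le_ciSup_of_le ⟨_, forall_mem_range.2 hub⟩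
    ⟨proxPoint S f g ℓ γ x, A.proxPoint_mem hγ.1 hx⟩ (le_ciInf fun i => ?_)
  -- The saddle inequality at the vertices of the simplex recovers the individual functions in the
  -- minimum.
  refine (A.dualObjective_le_lagrangian hx hγ (single_mem_stdSimplex ℝ i)).trans (le_of_eq ?_)
  rw [lagrangian_eq_sum (single_mem_stdSimplex ℝ i), Finset.sum_eq_single i]
  · simp
  · intro j _ hj; simp [hj]
  · simp

/-- The comparison inequality from which all differentiability properties are derived. -/
theorem Admissible.merit_sub_merit_le (A : Admissible S f g ℓ) {y z : E n} (hy : y ∈ S)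
    (hz : z ∈ S) {γ : Fin m → ℝ} (hγ : γ ∈ dualSolutions S f g ℓ z) :
    merit S f g ℓ y - merit S f g ℓ z ≤ ∑ i, γ i * (g i y - g i z)
      + (coupling f ℓ γ y (proxPoint S f g ℓ γ y) - coupling f ℓ γ z (proxPoint S f g ℓ γ y)) := by
  obtain ⟨γ', hγ'⟩ := A.dualSolutions_nonempty hy
  -- Here γ is only feasible for the dual problem at y, and `proxPoint S f g ℓ γ y` only feasible
  -- for the maximization at z. The values of the g_i at this common point cancel in the difference.
  have h1 : merit S f g ℓ y ≤ lagrangian f g ℓ γ y (proxPoint S f g ℓ γ y) := by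
    rw [A.merit_eq hy hγ', ← A.dualObjective_eq hγ.1 hy]
    exact hγ'.2 hγ.1
  have h2 : lagrangian f g ℓ γ z (proxPoint S f g ℓ γ y) ≤ merit S f g ℓ z := by
    rw [A.merit_eq hz hγ, A.dualObjective_eq hγ.1 hz]
    exact A.isMaxOn_proxPoint hγ.1 hz (A.proxPoint_mem hγ.1 hy)
  simp only [lagrangian] at h1 h2
  simp only [mul_sub, Finset.sum_sub_distrib]
  linarith

/-! ### Differentiability of the smooth part of the Lagrangian -/

theorem contDiffAt_gradient {f : E n → ℝ} {x : E n} (hf : ContDiffAt ℝ 2 f x) :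
    ContDiffAt ℝ 1 (gradient f) x :=
  ((InnerProductSpace.toDual ℝ (E n)).symm.toContinuousLinearEquiv.contDiff.contDiffAt).comp x
    (hf.fderiv_right (m := 1) (by norm_num))

theorem inner_hessian_comm {f : E n → ℝ} {x : E n} (hf : ContDiffAt ℝ 2 f x) (u v : E n) :
    inner ℝ (hessian f x u) v = inner ℝ (hessian f x v) u := by
  have hd : HasFDerivAt (gradient f) _ x :=
    ((InnerProductSpace.toDual ℝ (E n)).symm.toContinuousLinearEquiv.hasFDerivAt).comp x
      ((hf.fderiv_right (m := 1) (by norm_num)).differentiableAt one_ne_zero).hasFDerivAt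
  have h : ∀ u v, inner ℝ (hessian f x u) v = fderiv ℝ (fderiv ℝ f) x u v := by
    intro u v
    rw [hessian, hd.fderiv]
    exact InnerProductSpace.toDual_symm_apply
  rw [h, h]
  exact (hf.isSymmSndFDerivAt (by simp)).eq u v

theorem inner_wHess_comm {x : E n} (hf : ∀ i, ContDiffAt ℝ 2 (f i) x) (γ : Fin m → ℝ)
    (u v : E n) : inner ℝ (wHess f γ x u) v = inner ℝ (wHess f γ x v) u := by
  simp only [wHess, sum_apply, smul_apply, sum_inner,
    real_inner_smul_left, inner_hessian_comm (hf _) u v]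

/-- Joint smoothness, rather than smoothness in x alone, is what makes later estimates uniform in γ
and q. -/
theorem contDiffAt_coupling {x : E n} (hf : ∀ i, ContDiffAt ℝ 2 (f i) x) (γ : Fin m → ℝ)
    (q : E n) :
    ContDiffAt ℝ 1 (fun z : (Fin m → ℝ) × E n × E n => coupling f ℓ z.1 z.2.1 z.2.2)
      (γ, x, q) := by
  have hv : ContDiffAt ℝ 1 (fun z : (Fin m → ℝ) × E n × E n => wGrad f z.1 z.2.1)
      (γ, x, q) := by
    unfold wGrad
    refine ContDiffAt.sum fun i _ =>
      (by fun_prop : ContDiff ℝ 1 fun z : (Fin m → ℝ) × E n × E n => z.1 i).contDiffAt.smul ?_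
    exact (contDiffAt_gradient (hf i)).comp (γ, x, q) (f := fun z => z.2.1) (by fun_prop)
  unfold coupling
  exact (hv.inner ℝ (by fun_prop)).sub
    (contDiffAt_const.mul (ContDiffAt.norm_sq ℝ (by fun_prop)))

/-- The gradient of the smooth part of the Lagrangian with respect to `x`. -/
noncomputable def couplingGrad (f : Fin m → E n → ℝ) (ℓ : ℝ) (γ : Fin m → ℝ) (x q : E n) : E n :=
  wHess f γ x (x - q) + wGrad f γ x - ℓ • (x - q)

theorem couplingGrad_eq (hℓ : ℓ ≠ 0) (γ : Fin m → ℝ) (x q : E n) :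
    couplingGrad f ℓ γ x q = wGrad f γ x
      - ℓ • (ContinuousLinearMap.id ℝ (E n) - (1 / ℓ) • wHess f γ x) (x - q) := by
  simp only [couplingGrad, sub_apply, ContinuousLinearMap.id_apply,
    smul_apply, smul_sub, smul_smul, mul_one_div_cancel hℓ, one_smul]
  abel

theorem hasFDerivAt_coupling {x : E n} (hf : ∀ i, ContDiffAt ℝ 2 (f i) x) (γ : Fin m → ℝ)
    (q : E n) :
    HasFDerivAt (fun y => coupling f ℓ γ y q)
      (InnerProductSpace.toDual ℝ (E n) (couplingGrad f ℓ γ x q)) x := by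
  have hv : HasFDerivAt (fun y => wGrad f γ y) (wHess f γ x) x := by
    unfold wGrad wHess
    refine HasFDerivAt.fun_sum fun i _ => HasFDerivAt.const_smul ?_ (γ i)
    exact ((contDiffAt_gradient (hf i)).differentiableAt one_ne_zero).hasFDerivAt
  have hs : HasFDerivAt (fun y : E n => y - q) (ContinuousLinearMap.id ℝ (E n)) x :=
    (hasFDerivAt_id x).sub_const q
  refine ((hv.inner ℝ hs).sub (hs.norm_sq.const_mul (ℓ / 2))).congr_fderiv ?_
  ext d
  simp only [InnerProductSpace.toDual_apply_apply, couplingGrad, inner_add_left, inner_sub_left,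
    real_inner_smul_left, inner_wHess_comm hf γ (x - q) d]
  simp [fderivInnerCLM_apply]
  ring

theorem fderiv_coupling_apply {x : E n} (hf : ∀ i, ContDiffAt ℝ 2 (f i) x) (γ : Fin m → ℝ)
    (q d : E n) :
    fderiv ℝ (fun z : (Fin m → ℝ) × E n × E n => coupling f ℓ z.1 z.2.1 z.2.2) (γ, x, q) (0, d, 0)
      = inner ℝ (couplingGrad f ℓ γ x q) d := by
  have h1 : HasFDerivAt (fun y : E n => ((γ, y, q) : (Fin m → ℝ) × E n × E n))
      ((0 : E n →L[ℝ] (Fin m → ℝ)).prod ((ContinuousLinearMap.id ℝ (E n)).prod 0)) x :=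
    (hasFDerivAt_const γ x).prodMk ((hasFDerivAt_id x).prodMk (hasFDerivAt_const q x))
  have h0 := ((contDiffAt_coupling (ℓ := ℓ) hf γ q).differentiableAt one_ne_zero).hasFDerivAt
  have hc := HasFDerivAt.comp (f := fun y : E n => ((γ, y, q) : (Fin m → ℝ) × E n × E n)) x h0 h1
  have h2 := hc.unique (hasFDerivAt_coupling hf γ q)
  simpa using congrArg (fun T : E n →L[ℝ] ℝ => T d) h2

/-- Differences of the smooth part of the Lagrangian in `x`, uniformly in the multipliers and
in the proximal points. -/
theorem isLittleO_coupling {x : E n} (hf : ∀ i, ContDiffAt ℝ 2 (f i) x) {γ : Fin m → ℝ}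
    {q : E n} {ι : Type*} {l : Filter ι} {c : ι → Fin m → ℝ} {Q Y Z : ι → E n}
    (hc : Tendsto c l (𝓝 γ)) (hQ : Tendsto Q l (𝓝 q)) (hY : Tendsto Y l (𝓝 x))
    (hZ : Tendsto Z l (𝓝 x)) :
    (fun t => coupling f ℓ (c t) (Y t) (Q t) - coupling f ℓ (c t) (Z t) (Q t)
      - inner ℝ (couplingGrad f ℓ γ x q) (Y t - Z t)) =o[l] fun t => Y t - Z t := by
  have h := ((contDiffAt_coupling (ℓ := ℓ) hf γ q).hasStrictFDerivAt one_ne_zero).isLittleO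
  -- The two points share multiplier and proximal point, so strict differentiability of the joint
  -- function sees only `Y t - Z t`.
  have hT : Tendsto (fun t => ((c t, Y t, Q t), (c t, Z t, Q t))) l
      (𝓝 ((γ, x, q), (γ, x, q))) :=
    (hc.prodMk_nhds (hY.prodMk_nhds hQ)).prodMk_nhds (hc.prodMk_nhds (hZ.prodMk_nhds hQ))
  have h' := h.comp_tendsto hT
  simp only [Function.comp_def, Prod.mk_sub_mk, sub_self, fderiv_coupling_apply hf] at h'
  exact h'.trans_isBigO (Asymptotics.isBigO_of_le _ fun t => by simp [Prod.norm_def])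

/-! ### Directional derivatives of the merit function -/

theorem Admissible.tendsto_proxPoint (A : Admissible S f g ℓ) {ι : Type*} {l : Filter ι}
    {X : ι → E n} {c : ι → Fin m → ℝ} {x : E n} {γ : Fin m → ℝ} (hx : x ∈ S)
    (hγ : γ ∈ stdSimplex ℝ (Fin m)) (hX : Tendsto X l (𝓝[S] x)) (hc : Tendsto c l (𝓝 γ))
    (hcΔ : ∀ᶠ t in l, c t ∈ stdSimplex ℝ (Fin m)) :
    Tendsto (fun t => proxPoint S f g ℓ (c t) (X t)) l (𝓝 (proxPoint S f g ℓ γ x)) :=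
  tendsto_of_continuousOn_prod (fun x γ => proxPoint S f g ℓ γ x) A.continuousOn_proxPoint hx hγ
    hX (tendsto_nhdsWithin_iff.2 ⟨hc, hcΔ⟩)

/-- Covers both comparison bounds: multipliers and proximal points may move with t, and the filter
may be an ultrafilter finer than `𝓝[>] 0`. -/
theorem tendsto_dirDeriv_bound {x d : E n} (hf : ∀ i, ContDiffAt ℝ 2 (f i) x)
    {g' : Fin m → ℝ} (hg' : ∀ i, HasDirDeriv (g i) x d (g' i)) {γ : Fin m → ℝ} {q : E n}
    {l : Filter ℝ} (hl : l ≤ 𝓝[>] 0) {c : ℝ → Fin m → ℝ} {Q : ℝ → E n}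
    (hc : Tendsto c l (𝓝 γ)) (hQ : Tendsto Q l (𝓝 q)) :
    Tendsto (fun t => (∑ i, c t i * (g i (x + t • d) - g i x)
        + (coupling f ℓ (c t) (x + t • d) (Q t) - coupling f ℓ (c t) x (Q t))) / t) l
      (𝓝 (∑ i, γ i * g' i + inner ℝ (couplingGrad f ℓ γ x q) d)) := by
  have hY : Tendsto (fun t : ℝ => x + t • d) l (𝓝 x) := by
    have : Continuous fun t : ℝ => x + t • d := by fun_prop
    simpa using (this.tendsto 0).mono_left (hl.trans nhdsWithin_le_nhds)
  have hpos : ∀ᶠ t in l, 0 < t := hl self_mem_nhdsWithin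
  have h1 : Tendsto (fun t => ∑ i, c t i * ((g i (x + t • d) - g i x) / t)) l
      (𝓝 (∑ i, γ i * g' i)) :=
    tendsto_finsetSum _ fun i _ => ((tendsto_pi_nhds.1 hc) i).mul ((hg' i).mono_left hl)
  have h2 := isLittleO_coupling (ℓ := ℓ) hf hc hQ hY tendsto_const_nhds
  have h3 : (fun t : ℝ => x + t • d - x) =O[l] fun t : ℝ => t := by
    refine Asymptotics.IsBigO.of_bound ‖d‖ (Eventually.of_forall fun t => ?_)
    rw [add_sub_cancel_left, norm_smul, mul_comm]
  have h4 := (h2.trans_isBigO h3).tendsto_div_nhds_zero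
  have h5 := h1.add (h4.add_const (inner ℝ (couplingGrad f ℓ γ x q) d))
  rw [zero_add] at h5
  refine h5.congr' ?_
  filter_upwards [hpos] with t ht
  rw [add_sub_cancel_left, inner_smul_right, add_div, Finset.sum_div]
  simp only [mul_div_assoc]
  field_simp
  ring

/-- Danskin's formula for the merit function; the infimum over the dual solutions is attained. -/
theorem Admissible.exists_hasDirDeriv_merit (A : Admissible S f g ℓ) {x z : E n} (hx : x ∈ S)
    (hz : z ∈ S) (hf : ∀ i, ContDiffAt ℝ 2 (f i) x) {g' : Fin m → ℝ}
    (hg' : ∀ i, HasDirDeriv (g i) x (z - x) (g' i)) :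
    ∃ L : ℝ, HasDirDeriv (merit S f g ℓ) x (z - x) L ∧
      IsGLB ((fun γ : Fin m → ℝ => ∑ i, γ i * g' i
        + inner ℝ (couplingGrad f ℓ γ x (proxPoint S f g ℓ γ x)) (z - x))
          '' dualSolutions S f g ℓ x) L := by
  set d := z - x with hd
  set D : (Fin m → ℝ) → ℝ := fun γ => ∑ i, γ i * g' i
    + inner ℝ (couplingGrad f ℓ γ x (proxPoint S f g ℓ γ x)) d with hD
  have hpc : ContinuousOn (fun γ => proxPoint S f g ℓ γ x) (dualSolutions S f g ℓ x) :=
    A.continuousOn_proxPoint.comp (f := fun γ => (x, γ)) (by fun_prop) fun γ hγ => ⟨hx, hγ.1⟩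
  have hDc : ContinuousOn D (dualSolutions S f g ℓ x) := by
    have hH : Continuous fun γ : Fin m → ℝ => wHess f γ x := by unfold wHess; fun_prop
    have hv : Continuous fun γ : Fin m → ℝ => wGrad f γ x := by unfold wGrad; fun_prop
    have hG : ContinuousOn (fun γ => couplingGrad f ℓ γ x (proxPoint S f g ℓ γ x))
        (dualSolutions S f g ℓ x) :=
      ((hH.continuousOn.clm_apply (continuousOn_const.sub hpc)).add hv.continuousOn).sub
        ((continuousOn_const.sub hpc).const_smul ℓ)
    exact (Continuous.continuousOn (by fun_prop)).add (hG.inner continuousOn_const)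
  obtain ⟨γ₀, hγ₀, hmin⟩ := (A.isCompact_dualSolutions hx).exists_isMinOn
    (A.dualSolutions_nonempty hx) hDc
  refine ⟨D γ₀, ?_, IsLeast.isGLB ⟨mem_image_of_mem D hγ₀, ?_⟩⟩
  swap
  · rintro _ ⟨γ, hγ, rfl⟩
    exact hmin hγ
  have hX : Tendsto (fun t : ℝ => x + t • d) (𝓝[>] 0) (𝓝[S] x) := by
    refine tendsto_nhdsWithin_iff.2 ⟨?_, ?_⟩
    · have : Continuous fun t : ℝ => x + t • d := by fun_prop
      simpa using (this.tendsto 0).mono_left nhdsWithin_le_nhds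
    · filter_upwards [Ioc_mem_nhdsGT (zero_lt_one' ℝ)] with t ht
      exact A.convex.add_smul_sub_mem hx hz ⟨ht.1.le, ht.2⟩
  have hXS := (tendsto_nhdsWithin_iff.1 hX).2
  have hsel : ∀ y, ∃ γ, y ∈ S → γ ∈ dualSolutions S f g ℓ y := fun y => by
    by_cases hy : y ∈ S
    · exact (A.dualSolutions_nonempty hy).imp fun γ hγ _ => hγ
    · exact ⟨0, fun h => absurd h hy⟩
  choose σ hσ using hsel
  rw [HasDirDeriv, tendsto_iff_ultrafilter]
  intro U hU
  have hUS : ∀ᶠ t in (U : Filter ℝ), x + t • d ∈ S := hU hXS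
  have hpos : ∀ᶠ t in (U : Filter ℝ), 0 < t := hU self_mem_nhdsWithin
  have hmem : ∀ᶠ t in (U : Filter ℝ), σ (x + t • d) ∈ dualSolutions S f g ℓ (x + t • d) :=
    hUS.mono fun t ht => hσ _ ht
  obtain ⟨γ₁, -, h₁⟩ := (isCompact_stdSimplex ℝ (Fin m)).ultrafilter_le_nhds
    (U.map fun t => σ (x + t • d)) (by
      rw [le_principal_iff]
      exact hmem.mono fun t ht => ht.1)
  have hc₁ : Tendsto (fun t => σ (x + t • d)) (U : Filter ℝ) (𝓝 γ₁) := h₁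
  have hγ₁ := A.mem_dualSolutions_of_tendsto hx (hX.mono_left hU) hc₁ hmem
  -- The upper bound keeps the minimizing multiplier `γ₀` and moves the base point of the proximal
  -- map; the lower bound moves the multiplier and keeps the base point x.
  have hupper := tendsto_dirDeriv_bound (ℓ := ℓ) hf hg' hU (tendsto_const_nhds (x := γ₀))
    (A.tendsto_proxPoint hx hγ₀.1 (hX.mono_left hU) tendsto_const_nhds
      (Eventually.of_forall fun _ => hγ₀.1))
  have hlower := tendsto_dirDeriv_bound (ℓ := ℓ) hf hg' hU hc₁
    (A.tendsto_proxPoint hx hγ₁.1 (tendsto_const_nhdsWithin hx) hc₁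
      (hmem.mono fun t ht => ht.1))
  set B : (Fin m → ℝ) → E n → ℝ → ℝ := fun c q t => ∑ i, c i * (g i (x + t • d) - g i x)
    + (coupling f ℓ c (x + t • d) q - coupling f ℓ c x q)
  have hle : ∀ᶠ t in (U : Filter ℝ), (merit S f g ℓ (x + t • d) - merit S f g ℓ x) / t
      ≤ B γ₀ (proxPoint S f g ℓ γ₀ (x + t • d)) t / t := by
    filter_upwards [hUS, hpos] with t htS ht
    exact div_le_div_of_nonneg_right (A.merit_sub_merit_le htS hx hγ₀) ht.le
  have hge : ∀ᶠ t in (U : Filter ℝ),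
      B (σ (x + t • d)) (proxPoint S f g ℓ (σ (x + t • d)) x) t / t
        ≤ (merit S f g ℓ (x + t • d) - merit S f g ℓ x) / t := by
    filter_upwards [hUS, hpos, hmem] with t htS ht htm
    have h2 := A.merit_sub_merit_le hx htS htm
    refine div_le_div_of_nonneg_right ?_ ht.le
    simp only [B]
    simp only [mul_sub, Finset.sum_sub_distrib] at h2 ⊢
    linarith
  -- Since `γ₁` is itself a dual solution, minimality of `γ₀` makes the two limits equal and closes
  -- the squeeze.
  have hDle : D γ₁ ≤ D γ₀ := le_of_tendsto_of_tendsto hlower hupper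
    ((hge.and hle).mono fun t ht => ht.1.trans ht.2)
  have hDeq : D γ₁ = D γ₀ := le_antisymm hDle (hmin hγ₁)
  have hlower' : Tendsto _ (U : Filter ℝ) (𝓝 (D γ₁)) := hlower
  rw [hDeq] at hlower'
  exact tendsto_of_tendsto_of_tendsto_of_le_of_le' hlower' hupper hge hle

/-! ### Differentiability where the dual solution is unique -/

/-- If the increments of `h` are bounded by increments of `b` and of the smooth part of the
Lagrangian, then `h` is differentiable along any filter along which the `b i` are, provided the
dual solution is unique. -/
theorem Admissible.hasFDerivAtFilter (A : Admissible S f g ℓ) {x : E n} (hx : x ∈ S)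
    (hf : ∀ i, ContDiffAt ℝ 2 (f i) x) {γ : Fin m → ℝ} (hΓ : dualSolutions S f g ℓ x = {γ})
    {h : E n → ℝ} {b : Fin m → E n → ℝ} {b' : Fin m → E n →L[ℝ] ℝ} {l : Filter (E n × E n)}
    (hl : l ≤ 𝓝[S] x ×ˢ 𝓝[S] x) (hb : ∀ i, HasFDerivAtFilter (b i) (b' i) l)
    (hle : ∀ y ∈ S, ∀ z ∈ S, ∀ γ ∈ dualSolutions S f g ℓ z,
      h y - h z ≤ ∑ i, γ i * (b i y - b i z)
        + (coupling f ℓ γ y (proxPoint S f g ℓ γ y)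
          - coupling f ℓ γ z (proxPoint S f g ℓ γ y))) :
    HasFDerivAtFilter h (∑ i, γ i • b' i + InnerProductSpace.toDual ℝ (E n)
      (couplingGrad f ℓ γ x (proxPoint S f g ℓ γ x))) l := by
  have hγ : γ ∈ stdSimplex ℝ (Fin m) := by
    have : γ ∈ dualSolutions S f g ℓ x := by rw [hΓ]; rfl
    exact this.1
  have hsel : ∀ y, ∃ γ, y ∈ S → γ ∈ dualSolutions S f g ℓ y := fun y => by
    by_cases hy : y ∈ S
    · exact (A.dualSolutions_nonempty hy).imp fun γ hγ _ => hγ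
    · exact ⟨0, fun h => absurd h hy⟩
  choose σ hσ using hsel
  set T := ∑ i, γ i • b' i + InnerProductSpace.toDual ℝ (E n)
      (couplingGrad f ℓ γ x (proxPoint S f g ℓ γ x)) with hT
  have hfst : Tendsto Prod.fst l (𝓝[S] x) := tendsto_fst.mono_left hl
  have hsnd : Tendsto Prod.snd l (𝓝[S] x) := tendsto_snd.mono_left hl
  -- the upper bound, valid with the two points in either order
  have main : ∀ Y Z : E n × E n → E n, Tendsto Y l (𝓝[S] x) → Tendsto Z l (𝓝[S] x) →
      (∀ i, (fun t => b i (Y t) - b i (Z t) - b' i (Y t - Z t)) =o[l] fun t => Y t - Z t) →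
      ∀ ε > 0, ∀ᶠ t in l, h (Y t) - h (Z t) - T (Y t - Z t) ≤ ε * ‖Y t - Z t‖ := by
    intro Y Z hY hZ hbo ε hε
    obtain ⟨hY1, hY2⟩ := tendsto_nhdsWithin_iff.1 hY
    obtain ⟨hZ1, hZ2⟩ := tendsto_nhdsWithin_iff.1 hZ
    have hmem : ∀ᶠ t in l, σ (Z t) ∈ dualSolutions S f g ℓ (Z t) := hZ2.mono fun t ht => hσ _ ht
    have hc : Tendsto (fun t => σ (Z t)) l (𝓝 γ) :=
      A.tendsto_of_dualSolutions_eq_singleton hx hZ hΓ hmem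
    have hQ := A.tendsto_proxPoint hx hγ hY hc (hmem.mono fun t ht => ht.1)
    have h1 := isLittleO_coupling (ℓ := ℓ) hf hc hQ hY1 hZ1
    -- Replacing the moving multiplier by γ costs a bounded factor times a remainder, plus a
    -- vanishing factor times a bounded linear term.
    have h2 : (fun t => ∑ i, (σ (Z t) i * (b i (Y t) - b i (Z t) - b' i (Y t - Z t))
        + (σ (Z t) i - γ i) * b' i (Y t - Z t))) =o[l] fun t => Y t - Z t := by
      refine Asymptotics.IsLittleO.fun_sum fun i _ => ?_
      have hci := (tendsto_pi_nhds.1 hc) i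
      have h3 := (hci.isBigO_one ℝ).mul_isLittleO (hbo i).norm_right
      have h4 : (fun t => σ (Z t) i - γ i) =o[l] fun _ => (1 : ℝ) := by
        rw [Asymptotics.isLittleO_one_iff]
        simpa using hci.sub_const (γ i)
      have h5 := h4.mul_isBigO ((b' i).isBigO_comp (fun t => Y t - Z t) l).norm_right
      simp only [one_mul] at h3 h5
      exact h3.of_norm_right.add h5.of_norm_right
    filter_upwards [(h2.add h1).def hε, hY2, hZ2] with t ht htY htZ
    have h6 := hle _ htY _ htZ _ (hσ _ htZ)
    have h7 := (le_abs_self _).trans ht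
    refine le_trans ?_ h7
    have h8 : T (Y t - Z t) = ∑ i, γ i * b' i (Y t - Z t)
        + inner ℝ (couplingGrad f ℓ γ x (proxPoint S f g ℓ γ x)) (Y t - Z t) := by
      simp [hT]
    have h9 : ∑ i, (σ (Z t) i * (b i (Y t) - b i (Z t) - b' i (Y t - Z t))
        + (σ (Z t) i - γ i) * b' i (Y t - Z t))
        = ∑ i, σ (Z t) i * (b i (Y t) - b i (Z t)) - ∑ i, γ i * b' i (Y t - Z t) := by
      rw [← Finset.sum_sub_distrib]
      exact Finset.sum_congr rfl fun i _ => by ring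
    rw [h8, h9]
    linarith
  refine .of_isLittleO (Asymptotics.IsLittleO.of_bound fun ε hε => ?_)
  have m1 := main Prod.fst Prod.snd hfst hsnd (fun i => (hb i).isLittleO) ε hε
  have m2 := main Prod.snd Prod.fst hsnd hfst (fun i => by
    refine ((hb i).isLittleO.neg_left.neg_right).congr (fun t => ?_) fun t => by simp
    rw [← neg_sub t.1 t.2, map_neg]
    ring) ε hε
  filter_upwards [m1, m2] with t h1 h2
  rw [← neg_sub t.1 t.2, map_neg, norm_neg] at h2
  rw [Real.norm_eq_abs, abs_le]
  constructor <;> linarith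

/-- Under the same bounds, `h` is `C¹` near `x` if the `b i` are and the dual solutions are unique
near `x`. -/
theorem Admissible.contDiffWithinAt (A : Admissible S f g ℓ) {x : E n} (hx : x ∈ S)
    (hf : ∀ i, ContDiffAt ℝ 2 (f i) x)
    (hΓ : ∀ᶠ y in 𝓝[S] x, ∃ γ : Fin m → ℝ, dualSolutions S f g ℓ y = {γ})
    {h : E n → ℝ} {b : Fin m → E n → ℝ} (hb : ∀ i, ContDiffWithinAt ℝ 1 (b i) S x)
    (hle : ∀ y ∈ S, ∀ z ∈ S, ∀ γ ∈ dualSolutions S f g ℓ z,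
      h y - h z ≤ ∑ i, γ i * (b i y - b i z)
        + (coupling f ℓ γ y (proxPoint S f g ℓ γ y)
          - coupling f ℓ γ z (proxPoint S f g ℓ γ y))) :
    ContDiffWithinAt ℝ 1 h S x := by
  have hins : insert x S = S := insert_eq_of_mem hx
  have hb1 : ∀ i, ∃ u ∈ 𝓝[S] x, ∃ b' : E n → E n →L[ℝ] ℝ,
      (∀ y ∈ u, HasFDerivWithinAt (b i) (b' y) S y) ∧ ContDiffWithinAt ℝ 0 b' S x := by
    intro i
    have := hb i
    rw [← zero_add (1 : WithTop ℕ∞), contDiffWithinAt_succ_iff_hasFDerivWithinAt' (by simp)]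
      at this
    obtain ⟨u, hu, -, -, b', h1, h2⟩ := this
    exact ⟨u, hins ▸ hu, b', h1, h2⟩
  choose u hu b' hb' hb0 using hb1
  choose! σ hσ using fun (y : E n) (hy : ∃ γ : Fin m → ℝ, dualSolutions S f g ℓ y = {γ}) => hy
  have hf' : ∀ᶠ y in 𝓝[S] x, ∀ i, ContDiffAt ℝ 2 (f i) y := by
    rw [eventually_all]
    exact fun i => nhdsWithin_le_nhds ((hf i).eventually (by simp))
  have hbc : ∀ i, ∀ᶠ y in 𝓝[S] x, ContinuousWithinAt (b' i) S y := by
    intro i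
    obtain ⟨v, hv, hvc⟩ := contDiffWithinAt_zero hx |>.1 (hb0 i)
    filter_upwards [eventually_eventually_nhdsWithin.2 hv, hv, self_mem_nhdsWithin]
      with y hy hyv hyS
    exact (hvc y ⟨hyS, hyv⟩).mono_of_mem_nhdsWithin
      (inter_mem self_mem_nhdsWithin hy)
  set K : (Fin m → ℝ) × E n × E n → ℝ := fun z => coupling f ℓ z.1 z.2.1 z.2.2 with hK
  set p : E n → E n := fun y => proxPoint S f g ℓ (σ y) y with hp
  set J : E n →L[ℝ] (Fin m → ℝ) × E n × E n :=
    (0 : E n →L[ℝ] (Fin m → ℝ)).prod ((ContinuousLinearMap.id ℝ (E n)).prod 0) with hJ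
  set w : Set (E n) := {y | y ∈ S ∧ (∃ γ : Fin m → ℝ, dualSolutions S f g ℓ y = {γ}) ∧
    (∀ i, ContDiffAt ℝ 2 (f i) y) ∧ (∀ i, y ∈ u i) ∧ ∀ i, ContinuousWithinAt (b' i) S y} with hw
  have hwx : w ∈ 𝓝[S] x := by
    filter_upwards [self_mem_nhdsWithin, hΓ, hf', eventually_all.2 hu, eventually_all.2 hbc]
      with y h1 h2 h3 h4 h5 using ⟨h1, h2, h3, h4, h5⟩
  rw [← zero_add (1 : WithTop ℕ∞), contDiffWithinAt_succ_iff_hasFDerivWithinAt' (by simp), hins]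
  -- Writing the coupling part of the derivative through `fderiv ℝ K` reduces its continuity to the
  -- joint C¹ property and continuity of `σ` and `p`.
  refine ⟨w, hwx, fun y hy => hy.1, by simp,
    fun y => ∑ i, σ y i • b' i y + (fderiv ℝ K (σ y, y, p y)).comp J, ?_, ?_⟩
  · rintro y ⟨hyS, hyΓ, hyf, hyu, -⟩
    have h1 := A.hasFDerivAtFilter hyS hyf (hσ y hyΓ) (l := 𝓝[S] y ×ˢ pure y)
      (prod_mono le_rfl (pure_le_nhdsWithin hyS)) (fun i => hb' i y (hyu i)) hle
    have h2 : (fderiv ℝ K (σ y, y, p y)).comp J = InnerProductSpace.toDual ℝ (E n)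
        (couplingGrad f ℓ (σ y) y (p y)) := by
      ext d
      simpa [hJ] using fderiv_coupling_apply (ℓ := ℓ) hyf (σ y) (p y) d
    simp only [h2]
    exact h1
  · refine (contDiffWithinAt_zero hx).2 ⟨w, hwx, ?_⟩
    rintro y ⟨-, hyS, hyΓ, hyf, -, hyb⟩
    have hws : S ∩ w ⊆ S := inter_subset_left
    have hsub : 𝓝[S ∩ w] y ≤ 𝓝[S] y := nhdsWithin_mono y hws
    have hmem : ∀ᶠ t in 𝓝[S ∩ w] y, σ t ∈ dualSolutions S f g ℓ t := by
      filter_upwards [self_mem_nhdsWithin] with t ht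
      rw [hσ t ht.2.2.1]; rfl
    have hσc : Tendsto σ (𝓝[S ∩ w] y) (𝓝 (σ y)) :=
      A.tendsto_of_dualSolutions_eq_singleton hyS hsub (hσ y hyΓ) hmem
    have hσy : σ y ∈ stdSimplex ℝ (Fin m) := by
      have : σ y ∈ dualSolutions S f g ℓ y := by rw [hσ y hyΓ]; rfl
      exact this.1
    have hpc : Tendsto p (𝓝[S ∩ w] y) (𝓝 (p y)) :=
      A.tendsto_proxPoint hyS hσy hsub hσc (hmem.mono fun t ht => ht.1)
    have hKc : ContinuousAt (fderiv ℝ K) (σ y, y, p y) :=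
      (contDiffAt_coupling (ℓ := ℓ) hyf (σ y) (p y)).continuousAt_fderiv one_ne_zero
    have hid : Tendsto (fun t : E n => t) (𝓝[S ∩ w] y) (𝓝 y) := nhdsWithin_le_nhds
    have h3 : Tendsto (fun t => fderiv ℝ K (σ t, t, p t)) (𝓝[S ∩ w] y)
        (𝓝 (fderiv ℝ K (σ y, y, p y))) :=
      hKc.tendsto.comp (hσc.prodMk_nhds (hid.prodMk_nhds hpc))
    refine Tendsto.add (tendsto_finsetSum _ fun i _ =>
      ((tendsto_pi_nhds.1 hσc) i).smul ((hyb i).mono hws)) ?_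
    exact (((ContinuousLinearMap.compL ℝ (E n) ((Fin m → ℝ) × E n × E n) ℝ).flip
      J).continuous.tendsto _).comp h3

end CompositeMerit

theorem mainTheorem6 {n m : ℕ} (hm : 0 < m)
    (S : Set (E n)) (hS_ne : S.Nonempty) (hS_closed : IsClosed S) (hS_conv : Convex ℝ S)
    (f g : Fin m → E n → ℝ)
    (hf : ∀ i, ∀ y ∈ S, ContDiffAt ℝ 1 (f i) y)
    (hg_conv : ∀ i, ConvexOn ℝ S (g i)) (hg_cont : ∀ i, ContinuousOn (g i) S)
    (x : E n) (hx : x ∈ S) (hf2 : ∀ i, ContDiffAt ℝ 2 (f i) x)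
    (ℓ : ℝ) (hℓ : 0 < ℓ) :
    -- the directional derivative of `w_ℓ`
    (∀ z ∈ S, ∀ g' : Fin m → ℝ, (∀ i, HasDirDeriv (g i) x (z - x) (g' i)) →
      ∃ L : ℝ, HasDirDeriv (merit S f g ℓ) x (z - x) L ∧
        IsGLB ((fun γ : Fin m → ℝ =>
          ∑ i, γ i * g' i
            - ℓ * inner ℝ
                ((ContinuousLinearMap.id ℝ (E n) - (1 / ℓ) • wHess f γ x)
                    (x - prox (wReg S g ℓ γ) (x - (1 / ℓ) • wGrad f γ x))
                  - (1 / ℓ) • wGrad f γ x)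
                (z - x)) '' dualSolutions S f g ℓ x) L) ∧
    -- continuous differentiability of `w_ℓ` at `x` when `Γ(x)` is a singleton
    (∀ γ : Fin m → ℝ, dualSolutions S f g ℓ x = {γ} →
      ∀ a : Fin m → E n, (∀ i, HasContinuousGradientAt S (g i) (a i) x) →
        HasContinuousGradientAt S (merit S f g ℓ)
          (∑ i, γ i • (gradient (f i) x + a i)
            - ℓ • (ContinuousLinearMap.id ℝ (E n) - (1 / ℓ) • wHess f γ x)
                (x - prox (wReg S g ℓ γ) (x - (1 / ℓ) • wGrad f γ x))) x) ∧
    -- `w_ℓ` is `C¹` around `x` when `Γ` is single-valued around `x`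
    ((∀ᶠ y in 𝓝[S] x, ∃ γ : Fin m → ℝ, dualSolutions S f g ℓ y = {γ}) →
      (∀ i, ContDiffWithinAt ℝ 1 (g i) S x) →
        ContDiffWithinAt ℝ 1 (merit S f g ℓ) S x) ∧
    -- the same for `w_ℓ - g₁` when all the `g_i` coincide, without differentiability of `g₁`
    (∀ g₁ : E n → ℝ, (∀ i, EqOn (g i) g₁ S) →
      (∀ γ : Fin m → ℝ, dualSolutions S f g ℓ x = {γ} →
        HasContinuousGradientAt S (fun y => merit S f g ℓ y - g₁ y)
          (- (ℓ • (ContinuousLinearMap.id ℝ (E n) - (1 / ℓ) • wHess f γ x)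
                (x - prox (scaledAddIndicator S ℓ g₁) (x - (1 / ℓ) • wGrad f γ x)))
            + wGrad f γ x) x) ∧
      ((∀ᶠ y in 𝓝[S] x, ∃ γ : Fin m → ℝ, dualSolutions S f g ℓ y = {γ}) →
        ContDiffWithinAt ℝ 1 (fun y => merit S f g ℓ y - g₁ y) S x)) := by
  have A : Admissible S f g ℓ := ⟨hS_ne, hS_closed, hS_conv,
    fun i y hy => (continuousAt_gradient (hf i y hy)).continuousWithinAt, hg_conv, hg_cont, hℓ, hm⟩
  refine ⟨fun z hz g' hg' => ?_, fun γ hΓ a ha => ?_, fun hΓ hg => ?_, fun g₁ hg₁ => ⟨fun γ hΓ => ?_,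
    fun hΓ => ?_⟩⟩
  · obtain ⟨L, hL, hglb⟩ := A.exists_hasDirDeriv_merit hx hz hf2 hg'
    refine ⟨L, hL, ?_⟩
    convert hglb using 3 with γ
    rw [couplingGrad_eq hℓ.ne', proxPoint, inner_sub_left, inner_sub_left, real_inner_smul_left,
      real_inner_smul_left]
    field_simp
    ring
  · refine .of_strict hS_conv hx ?_
    refine cast (congrArg (fun T => HasFDerivAtFilter (merit S f g ℓ) T _) ?_)
      (A.hasFDerivAtFilter hx hf2 hΓ le_rfl (fun i => (ha i).strict)
        (fun y hy z hz γ hγ => A.merit_sub_merit_le hy hz hγ))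
    rw [couplingGrad_eq hℓ.ne']
    simp only [wGrad, smul_add, Finset.sum_add_distrib, map_add, map_sub, map_sum, map_smul,
      proxPoint]
    abel
  · exact A.contDiffWithinAt hx hf2 hΓ hg fun y hy z hz γ hγ => A.merit_sub_merit_le hy hz hγ
  -- With identical g_i the regularizer increments cancel exactly, so the general results apply with
  -- all `b i` equal to zero.
  all_goals
    have hle : ∀ y ∈ S, ∀ z ∈ S, ∀ γ ∈ dualSolutions S f g ℓ z,
        (merit S f g ℓ y - g₁ y) - (merit S f g ℓ z - g₁ z) ≤
          ∑ i, γ i * ((0 : Fin m → E n → ℝ) i y - (0 : Fin m → E n → ℝ) i z)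
          + (coupling f ℓ γ y (proxPoint S f g ℓ γ y)
            - coupling f ℓ γ z (proxPoint S f g ℓ γ y)) := by
      intro y hy z hz γ hγ
      have h1 := A.merit_sub_merit_le hy hz hγ
      have h2 : ∑ i, γ i * (g i y - g i z) = g₁ y - g₁ z := by
        simp only [hg₁ _ hy, hg₁ _ hz]
        rw [← Finset.sum_mul, hγ.1.2, one_mul]
      rw [h2] at h1
      simp only [Pi.zero_apply, sub_self, mul_zero, Finset.sum_const_zero]
      linarith
  · refine .of_strict hS_conv hx ?_
    have hγ : γ ∈ dualSolutions S f g ℓ x := by rw [hΓ]; rfl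
    -- The functions agree on S because the weights sum to one, and both are `⊤` off S.
    have hreg : scaledAddIndicator S ℓ g₁ = wReg S g ℓ γ := by
      funext y
      by_cases hy : y ∈ S
      · have : ∑ i, γ i * g i y = g₁ y := by
          simp only [hg₁ _ hy]
          rw [← Finset.sum_mul, hγ.1.2, one_mul]
        simp only [wReg, scaledAddIndicator, this]
      · simp only [wReg, scaledAddIndicator, indicatorFn, if_neg hy, EReal.coe_add_top]
    refine cast (congrArg (fun T => HasFDerivAtFilter (fun y => merit S f g ℓ y - g₁ y) T _) ?_)
      (A.hasFDerivAtFilter hx hf2 hΓ le_rfl (b' := 0) (fun i => hasFDerivAtFilter_const 0 _) hle)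
    rw [couplingGrad_eq hℓ.ne', hreg]
    simp only [Pi.zero_apply, smul_zero, Finset.sum_const_zero, zero_add, proxPoint]
    congr 1
    abel
  · exact A.contDiffWithinAt hx hf2 hΓ (fun i => contDiffWithinAt_const) hle
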